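/- Let $d\ge 1$, let $U=\{e\in\mathbb Z^d:|e|_1=1\}$, let $\mathcal P$ be the set of probability vectors $(p(e))_{e\in U}$, and let $\Omega=\mathcal P^{\mathbb Z^d}$ carry the product topology and its Borel $\sigma$-algebra $\mathcal B(\Omega)$; write $\omega(x,e)$ for the components of $\omega\in\Omega$ and $(t_y\omega)(x,e)=\omega(x+y,e)$ for $y\in\mathbb Z^d$. For $\omega\in\Omega$ and $x\in\mathbb Z^d$ let $P_{x,\omega}$ be the law on $(\mathbb Z^d)^{\mathbb N}$ of the Markov chain $(X_n)_{n\ge 0}$ with $X_0=x$ which jumps from $y$ to $y+e$ with probability $\omega(y,e)$, $e\in U$. For a probability measure $\mathbb P$ on $\Omega$ let $P_{x,\mathbb P}$ be the measure on $\Omega\times(\mathbb Z^d)^{\mathbb N}$ given by $P_{x,\mathbb P}[F\times G]=\int_F P_{x,\omega}[G]\,\mathbb P(d\omega)$, and let $P_x$ be its marginal on $(\mathbb Z^d)^{\mathbb N}$ (the annealed law). Let $\mathbb P$ be a probability measure on $\Omega$ such that * (ellipticity) for every $x\in\mathbb Z^d$, $\mathbb P[\min_{e\in U}\omega(x,e)>0]=1$;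 * (ergodicity) every $A\in\mathcal B(\Omega)$ with $t_x^{-1}(A)=A$ for all $x\in\mathbb Z^d$ satisfies $\mathbb P(A)\in\{0,1\}$. Suppose that $\nu$ is a probability measure on $\Omega$ which is absolutely continuous with respect to $\mathbb P$ and invariant for the environment viewed from the particle $(t_{X_n}\omega)_{n\ge 0}$, that is, $\int Rf\,d\nu=\int f\,d\nu$ for every bounded continuous $f:\Omega\to\mathbb R$, where $Rf(\omega)=\sum_{e\in U}\omega(0,e)f(t_e\omega)$. Then, $P_{0,\mathbb P}$-almost surely, $$\lim_{n\to\infty}\frac{X_n}{n}=v:=\int d(0,\omega)\,\nu(d\omega),\qquad d(x,\omega):=\sum_{e\in U}\omega(x,e)\,e .$$ Furthermore, let $l\in\mathbb R^d$ with $|l|_2=1$. If the walk is transient in direction $l$, i.e. $P_0[\lim_{n\to\infty}X_n\cdot l=\infty]=1$, then it is ballistic in direction $l$, i.e. $\liminf_{n\to\infty}X_n\cdot l/n>0$ holds $P_0$-almost surely, and $v\cdot l\neq 0$. -/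

import Mathlib

open MeasureTheory ProbabilityTheory Filter Topology
open scoped BoundedContinuousFunction

namespace RWRE

/-- The lattice `ℤ^d`. -/
abbrev Lattice (d : ℕ) : Type := Fin d → ℤ

/-- The set `U` of possible jumps: lattice points of `ℓ¹`-norm one. -/
abbrev Jump (d : ℕ) : Type := {e : Lattice d // ∑ i, |e i| = 1}

instance finite_jump (d : ℕ) : Finite (Jump d) := by
  refine ((Set.finite_Icc (-1 : Lattice d) 1).subset ?_).to_subtype
  intro e (he : ∑ i, |e i| = 1)
  have h : ∀ i, |e i| ≤ 1 := fun i =>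
    he ▸ Finset.single_le_sum (f := fun i => |e i|) (fun j _ => abs_nonneg _) (Finset.mem_univ i)
  exact ⟨fun i => (abs_le.1 (h i)).1, fun i => (abs_le.1 (h i)).2⟩

noncomputable instance fintype_jump (d : ℕ) : Fintype (Jump d) := Fintype.ofFinite _

/-- The environment space `𝒫^(ℤ^d)`, where `𝒫` is the set of probability vectors on `U`. It carries
the product topology and the product (equivalently, Borel) `σ`-algebra. -/
abbrev Env (d : ℕ) : Type := Lattice d → stdSimplex ℝ (Jump d)

/-- The translations `(t_y ω)(x, e) = ω(x + y, e)`. -/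
def shift {d : ℕ} (y : Lattice d) (ω : Env d) : Env d := fun x => ω (x + y)

/-- The law of the position after one step from `y` in the environment `ω`. -/
noncomputable def stepLaw {d : ℕ} (ω : Env d) (y : Lattice d) : Measure (Lattice d) :=
  ∑ e : Jump d, ENNReal.ofReal (ω y e) • Measure.dirac (y + e.1)

instance isProbabilityMeasure_stepLaw {d : ℕ} (ω : Env d) (y : Lattice d) :
    IsProbabilityMeasure (stepLaw ω y) := by
  constructor
  have h : ∑ e : Jump d, ENNReal.ofReal (ω y e) = 1 := by
    refine (ENNReal.ofReal_sum_of_nonneg fun e _ => (ω y).2.1 e).symm.trans ?_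
    exact (congrArg ENNReal.ofReal (ω y).2.2).trans ENNReal.ofReal_one
  simpa [stepLaw] using h

/-- The kernel giving the law of `X_(n+1)` from the history `X_0, …, X_n`; it depends on the history
only through `X_n`. -/
noncomputable def stepKernel {d : ℕ} (ω : Env d) (n : ℕ) :
    Kernel (Finset.Iic n → Lattice d) (Lattice d) where
  toFun h := stepLaw ω (h ⟨n, Finset.mem_Iic.2 le_rfl⟩)
  measurable' := measurable_of_countable _

instance isMarkovKernel_stepKernel {d : ℕ} (ω : Env d) (n : ℕ) :
    IsMarkovKernel (stepKernel ω n) :=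
  ⟨fun _ => isProbabilityMeasure_stepLaw ω _⟩

/-- The quenched law `P_{x,ω}` of the walk in the environment `ω` started at `x`, on the space of
trajectories. -/
noncomputable def quenchedLaw {d : ℕ} (x : Lattice d) (ω : Env d) : Measure (ℕ → Lattice d) :=
  Kernel.traj (X := fun _ => Lattice d) (stepKernel ω) 0 (fun _ => x)

instance isProbabilityMeasure_quenchedLaw {d : ℕ} (x : Lattice d) (ω : Env d) :
    IsProbabilityMeasure (quenchedLaw x ω) := by
  unfold quenchedLaw
  infer_instance

lemma measurable_stepLaw_apply {d : ℕ} (y : Lattice d) (s : Set (Lattice d)) :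
    Measurable fun ω : Env d => stepLaw ω y s := by
  have h : ∀ e : Jump d, Measurable fun ω : Env d => (ω y e : ℝ) := fun e =>
    (measurable_pi_apply e).comp (measurable_subtype_coe.comp (measurable_pi_apply y))
  simp only [stepLaw, Measure.coe_finsetSum, Finset.sum_apply, Measure.smul_apply, smul_eq_mul]
  exact Finset.measurable_sum _ fun e _ => ((h e).ennreal_ofReal).mul_const _

lemma measurable_partialTraj_apply {d : ℕ} (x : Lattice d) (n : ℕ)
    (s : Set (Finset.Iic n → Lattice d)) :
    Measurable fun ω : Env d =>
      Kernel.partialTraj (X := fun _ => Lattice d) (stepKernel ω) 0 n (fun _ => x) s := by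
  induction n with
  | zero => simp only [Kernel.partialTraj_zero, Kernel.deterministic_apply, measurable_const]
  | succ n ih =>
    have hs : MeasurableSet s := s.to_countable.measurableSet
    have key : ∀ ω : Env d,
        Kernel.partialTraj (X := fun _ => Lattice d) (stepKernel ω) 0 (n + 1) (fun _ => x) s =
          ∑' h : Finset.Iic n → Lattice d,
            stepLaw ω (h ⟨n, Finset.mem_Iic.2 le_rfl⟩)
              {y | IicProdIoc (X := fun _ => Lattice d) n (n + 1)
                (h, MeasurableEquiv.piSingleton (X := fun _ => Lattice d) n y) ∈ s} *
            Kernel.partialTraj (X := fun _ => Lattice d) (stepKernel ω) 0 n (fun _ => x) {h} := by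
      intro ω
      have hI : Measurable (IicProdIoc (X := fun _ => Lattice d) n (n + 1)) :=
        measurable_IicProdIoc
      have hm : MeasurableSet (IicProdIoc (X := fun _ => Lattice d) n (n + 1) ⁻¹' s) :=
        hI hs
      rw [Kernel.partialTraj_succ_of_le (Nat.zero_le n),
        Kernel.map_apply' _ hI _ hs, Kernel.comp_apply' _ _ _ hm,
        lintegral_countable']
      refine tsum_congr fun h => ?_
      congr 1
      have := Kernel.IsMarkovKernel.map (stepKernel ω n)
        (MeasurableEquiv.piSingleton (X := fun _ => Lattice d) n).measurable
      rw [Kernel.prod_apply, Kernel.id_apply, Measure.dirac_prod,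
        Measure.map_apply measurable_prodMk_left hm,
        Kernel.map_apply' _ (MeasurableEquiv.measurable _) _ (measurable_prodMk_left hm)]
      rfl
    simp only [key]
    exact Measurable.tsum fun h => (measurable_stepLaw_apply _ _).mul (ih _)

lemma measurable_quenchedLaw {d : ℕ} (x : Lattice d) :
    Measurable fun ω : Env d => quenchedLaw x ω := by
  refine Measurable.measure_of_isPiSystem_of_isProbabilityMeasure
    (generateFrom_measurableCylinders (α := fun _ : ℕ => Lattice d)).symm
    isPiSystem_measurableCylinders ?_
  intro t ht
  obtain ⟨n, S, hS, rfl⟩ : ∃ n, ∃ S : Set (Finset.Iic n → Lattice d), MeasurableSet S ∧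
      t = Preorder.frestrictLe (π := fun _ => Lattice d) n ⁻¹' S := by
    obtain ⟨I, S, hS, rfl⟩ := (mem_measurableCylinders t).1 ht
    refine ⟨I.sup id, Finset.restrict₂ (π := fun _ => Lattice d) I.subset_Iic_sup_id ⁻¹' S,
      (Finset.measurable_restrict₂ _) hS, rfl⟩
  have key : ∀ ω : Env d,
      quenchedLaw x ω (Preorder.frestrictLe (π := fun _ => Lattice d) n ⁻¹' S) =
        Kernel.partialTraj (X := fun _ => Lattice d) (stepKernel ω) 0 n (fun _ => x) S := by
    intro ω
    rw [← Kernel.traj_map_frestrictLe, Kernel.map_apply' _ (by fun_prop) _ hS]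
    rfl
  simp only [key]
  exact measurable_partialTraj_apply x n S

/-- The quenched law `ω ↦ P_{x,ω}` as a Markov kernel. -/
noncomputable def quenchedKernel {d : ℕ} (x : Lattice d) : Kernel (Env d) (ℕ → Lattice d) where
  toFun ω := quenchedLaw x ω
  measurable' := measurable_quenchedLaw x

instance isMarkovKernel_quenchedKernel {d : ℕ} (x : Lattice d) :
    IsMarkovKernel (quenchedKernel x) :=
  ⟨fun ω => isProbabilityMeasure_quenchedLaw x ω⟩

/-- The semi-direct product `P_{x,ℙ}` of `ℙ` and `P_{x,ω}`, on pairs (environment, trajectory). -/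
noncomputable def jointLaw {d : ℕ} (P : Measure (Env d)) (x : Lattice d) :
    Measure (Env d × (ℕ → Lattice d)) :=
  P ⊗ₘ quenchedKernel x

/-- The annealed law `P_x`: the marginal of `P_{x,ℙ}` on trajectories. -/
noncomputable def annealedLaw {d : ℕ} (P : Measure (Env d)) (x : Lattice d) :
    Measure (ℕ → Lattice d) :=
  (jointLaw P x).snd

/-- Ellipticity: at every site, almost surely, all jump probabilities are positive. -/
def IsElliptic {d : ℕ} (P : Measure (Env d)) : Prop :=
  ∀ x : Lattice d, ∀ᵐ ω ∂P, ∀ e : Jump d, 0 < ω x e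

/-- Total ergodicity: every event invariant under all translations has probability `0` or `1`. -/
def IsTotallyErgodic {d : ℕ} (P : Measure (Env d)) : Prop :=
  ∀ A : Set (Env d), MeasurableSet A → (∀ x : Lattice d, shift x ⁻¹' A = A) → P A = 0 ∨ P A = 1

/-- The transition operator `Rf(ω) = ∑_e ω(0, e) f(t_e ω)` of the environment viewed from the
particle. -/
noncomputable def envOp {d : ℕ} (f : Env d → ℝ) (ω : Env d) : ℝ :=
  ∑ e : Jump d, ω 0 e * f (shift e.1 ω)

/-- Invariance of a measure for the environment viewed from the particle. -/
def IsEnvInvariant {d : ℕ} (ν : Measure (Env d)) : Prop :=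
  ∀ f : Env d →ᵇ ℝ, ∫ ω, envOp f ω ∂ν = ∫ ω, f ω ∂ν

/-- The inclusion of `ℤ^d` in Euclidean space. -/
noncomputable def toEuclidean {d : ℕ} (x : Lattice d) : EuclideanSpace ℝ (Fin d) :=
  WithLp.toLp 2 fun i => (x i : ℝ)

/-- The local drift `d(x, ω) = ∑_e ω(x, e) e`. -/
noncomputable def localDrift {d : ℕ} (x : Lattice d) (ω : Env d) : EuclideanSpace ℝ (Fin d) :=
  ∑ e : Jump d, (ω x e) • toEuclidean e.1

/-- Transience in direction `l`: `X_n · l → ∞` almost surely under the annealed law from `0`. -/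
def IsTransientInDirection {d : ℕ} (P : Measure (Env d)) (l : EuclideanSpace ℝ (Fin d)) : Prop :=
  ∀ᵐ X ∂(annealedLaw P 0), Tendsto (fun n : ℕ => inner ℝ (toEuclidean (X n)) l) atTop atTop

/-- Ballisticity in direction `l`: `liminf X_n · l / n > 0` almost surely under the annealed law
from `0`; the lower limit is taken in the extended reals. -/
def IsBallisticInDirection {d : ℕ} (P : Measure (Env d)) (l : EuclideanSpace ℝ (Fin d)) : Prop :=
  ∀ᵐ X ∂(annealedLaw P 0),
    0 < liminf (fun n : ℕ => ((inner ℝ (toEuclidean (X n)) l / n : ℝ) : EReal)) atTop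

end RWRE

/-! Seen from the particle, the walk is a measure-preserving system: `walkShift` recentres the
environment and the remaining trajectory after one step, and it preserves `jointLaw ν 0` because ν
is stationary. The displacement `X_n · l` is a Birkhoff sum of the bounded first increment, whose
mean is `v · l`. If `walkShift` is ergodic, the pointwise ergodic theorem gives the velocity under
ν.

Ergodicity (`ergodic_walkShift`): for an invariant event `A`, the quenched probability `h ω` of `A`
is harmonic for the environment chain. Stationarity makes its one-step variance vanish, so by
ellipticity `h` is invariant under all translations, and total ergodicity of `P` makes it constant.
Then `A` is independent of every cylinder, hence of itself, and has probability 0 or 1.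

The measures ν and `P` are equivalent: ν-null sets are stable under translation, so ergodicity
forces `P ≪ ν`. Thus the limit passes from ν to `P`, and transience passes from `P` to ν.

Ballisticity rests on a general fact (`integral_pos_of_tendsto_birkhoffSum_atTop`): over an ergodic
map, Birkhoff sums of an integrable function that tend to infinity have strictly positive mean. -/

open scoped ENNReal

namespace RWRE

/-! ### Birkhoff sums over an ergodic map -/

section Ergodic

variable {α : Type*} {T : α → α} {f : α → ℝ}

/-- The running maximum of the Birkhoff sums of `f` up to time `n`. -/
noncomputable def birkhoffMax (T : α → α) (f : α → ℝ) : ℕ → α → ℝ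
  | 0, _ => 0
  | n + 1, x => max 0 (f x + birkhoffMax T f n (T x))

lemma birkhoffMax_nonneg (n : ℕ) (x : α) : 0 ≤ birkhoffMax T f n x := by
  cases n with
  | zero => exact le_rfl
  | succ n => exact le_max_left _ _

lemma birkhoffMax_le_succ (n : ℕ) : ∀ x, birkhoffMax T f n x ≤ birkhoffMax T f (n + 1) x := by
  induction n with
  | zero => exact fun x => birkhoffMax_nonneg 1 x
  | succ n ih => exact fun x => max_le_max le_rfl (by gcongr; exact ih _)

lemma birkhoffMax_mono (x : α) : Monotone fun n => birkhoffMax T f n x :=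
  monotone_nat_of_le_succ fun n => birkhoffMax_le_succ n x

lemma birkhoffSum_le_birkhoffMax (n : ℕ) : ∀ x, birkhoffSum T f n x ≤ birkhoffMax T f n x := by
  induction n with
  | zero => intro x; simp [birkhoffMax]
  | succ n ih =>
    intro x
    rw [birkhoffSum_succ']
    exact le_max_of_le_right (by gcongr; exact ih _)

lemma birkhoffSum_add_const (c : ℝ) (n : ℕ) (x : α) :
    birkhoffSum T (fun y => f y + c) n x = birkhoffSum T f n x + n * c := by
  simp [birkhoffSum, Finset.sum_add_distrib]

variable [MeasurableSpace α] {μ : Measure α}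

lemma measurable_birkhoffMax (hT : Measurable T) (hf : Measurable f) (n : ℕ) :
    Measurable (birkhoffMax T f n) := by
  induction n with
  | zero => exact measurable_const
  | succ n ih => exact measurable_const.max (hf.add (ih.comp hT))

lemma integrable_birkhoffMax [IsFiniteMeasure μ] (hT : MeasurePreserving T μ μ)
    (hf : Integrable f μ) (n : ℕ) : Integrable (birkhoffMax T f n) μ := by
  induction n with
  | zero => exact integrable_const 0
  | succ n ih => exact (integrable_const 0).sup (hf.add (hT.integrable_comp_of_integrable ih))

/-- For an ergodic map, the Birkhoff sums of a function with negative mean are almost surely bounded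
above. -/
theorem ae_birkhoffSum_le_of_integral_neg [IsProbabilityMeasure μ] (hT : Ergodic T μ)
    (hfm : Measurable f) (hf : Integrable f μ) (hneg : ∫ x, f x ∂μ < 0) :
    ∀ᵐ x ∂μ, ∃ C : ℝ, ∀ n, birkhoffSum T f n x ≤ C := by
  have hM := measurable_birkhoffMax hT.measurable hfm
  have hI := integrable_birkhoffMax hT.toMeasurePreserving hf
  set A : Set α := {x | ∀ N : ℕ, ∃ n, (N : ℝ) < birkhoffMax T f n x} with hA
  have hAm : MeasurableSet A := by
    have : A = ⋂ N : ℕ, ⋃ n, {x | (N : ℝ) < birkhoffMax T f n x} := by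
      ext x; simp [hA]
    rw [this]
    exact .iInter fun N => .iUnion fun n => measurableSet_lt measurable_const (hM n)
  have hAT : T ⁻¹' A = A := by
    ext x
    constructor
    · intro h N
      obtain ⟨K, hK⟩ := exists_nat_gt (N - f x)
      obtain ⟨n, hn⟩ := h K
      exact ⟨n + 1, lt_max_of_lt_right (by linarith)⟩
    · intro h N
      -- Being positive, `K` rules out that the maximum is attained by the entry 0; exceeding `N + f
      -- x`, it leaves more than `N` for the maximum at `T x`.
      obtain ⟨K, hK⟩ := exists_nat_gt (max 0 (N + f x))
      obtain ⟨n, hn⟩ := h K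
      cases n with
      | zero => exact absurd (hn : (K : ℝ) < 0) (not_lt.2 (Nat.cast_nonneg _))
      | succ n =>
        refine ⟨n, ?_⟩
        have h1 := (le_max_left 0 (N + f x)).trans_lt hK
        have h2 := (le_max_right 0 (N + f x)).trans_lt hK
        rcases lt_max_iff.1 hn with h3 | h3 <;> linarith
  rcases hT.ae_mem_or_ae_notMem hAm hAT with h | h
  · exfalso
    -- `D n` has nonnegative integral by invariance of μ and monotonicity in `n`. Where the maxima
    -- at `T x` are unbounded, `D n x` is eventually `f x`; domination by `|f|` then gives `∫ f ≥
    -- 0`, a contradiction.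
    set D : ℕ → α → ℝ := fun n x => birkhoffMax T f (n + 1) x - birkhoffMax T f n (T x) with hD
    have hDnn : ∀ n, 0 ≤ ∫ x, D n x ∂μ := by
      intro n
      have h1 : ∫ x, birkhoffMax T f n (T x) ∂μ = ∫ x, birkhoffMax T f n x ∂μ := by
        have := integral_map (μ := μ) (f := birkhoffMax T f n) hT.measurable.aemeasurable
          (hM n).aestronglyMeasurable
        rw [hT.map_eq] at this
        exact this.symm
      have h2 : Integrable (fun x => birkhoffMax T f n (T x)) μ :=
        hT.toMeasurePreserving.integrable_comp_of_integrable (hI n)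
      rw [hD, integral_sub (hI _) h2, h1, sub_nonneg]
      exact integral_mono (hI _) (hI _) (birkhoffMax_le_succ n)
    have hlim : Tendsto (fun n => ∫ x, D n x ∂μ) atTop (𝓝 (∫ x, f x ∂μ)) := by
      refine tendsto_integral_of_dominated_convergence (fun x => |f x|)
        (fun n => ((hM _).sub ((hM n).comp hT.measurable)).aestronglyMeasurable) hf.abs
        (fun n => ae_of_all _ fun x => ?_) ?_
      · have h0 := birkhoffMax_nonneg (T := T) (f := f) n (T x)
        simp only [hD, birkhoffMax, Real.norm_eq_abs]
        rcases max_cases 0 (f x + birkhoffMax T f n (T x)) with ⟨h1, h2⟩ | ⟨h1, h2⟩ <;> rw [h1]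
        · rw [abs_le]
          constructor <;> cases abs_cases (f x) <;> linarith
        · simp
      · filter_upwards [h] with x hx
        rw [← hAT] at hx
        obtain ⟨K, hK⟩ := exists_nat_gt (-f x)
        obtain ⟨n, hn⟩ := hx K
        refine tendsto_const_nhds.congr' ?_
        filter_upwards [eventually_ge_atTop n] with m hm
        have := birkhoffMax_mono (T := T) (f := f) (T x) hm
        simp only at this
        simp only [hD, birkhoffMax]
        rw [max_eq_right (by linarith)]
        ring
    exact absurd (ge_of_tendsto' hlim hDnn) (not_le.2 hneg)
  · filter_upwards [h] with x hx
    simp only [hA, Set.mem_ofPred_eq, not_forall, not_exists, not_lt] at hx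
    obtain ⟨N, hN⟩ := hx
    exact ⟨N, fun n => (birkhoffSum_le_birkhoffMax n x).trans (hN n)⟩

/-- The pointwise ergodic theorem for ergodic maps. -/
theorem ae_tendsto_birkhoffSum_div [IsProbabilityMeasure μ] (hT : Ergodic T μ)
    (hfm : Measurable f) (hf : Integrable f μ) :
    ∀ᵐ x ∂μ, Tendsto (fun n : ℕ => birkhoffSum T f n x / n) atTop (𝓝 (∫ x, f x ∂μ)) := by
  -- The added constant makes the mean equal to `-1 / (k + 1) < 0`. Applied to `f` and `-f`, the
  -- resulting upper bounds squeeze the averages from both sides.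
  have key : ∀ g : α → ℝ, Measurable g → Integrable g μ → ∀ᵐ x ∂μ, ∀ k : ℕ, ∃ C : ℝ, ∀ n,
      birkhoffSum T g n x + n * (-∫ x, g x ∂μ - 1 / (k + 1)) ≤ C := by
    intro g hgm hg
    refine ae_all_iff.2 fun k => ?_
    have hpos : (0 : ℝ) < 1 / (k + 1) := by positivity
    have := ae_birkhoffSum_le_of_integral_neg (f := fun y => g y + (-∫ x, g x ∂μ - 1 / (k + 1)))
      hT (hgm.add_const _) (hg.add (integrable_const _)) (by
        rw [integral_add hg (integrable_const _)]
        simp only [integral_const, probReal_univ, one_smul]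
        linarith)
    simpa only [birkhoffSum_add_const] using this
  filter_upwards [key f hfm hf, key (fun x => -f x) hfm.neg hf.neg] with x h1 h2
  rw [Metric.tendsto_atTop]
  intro ε hε
  obtain ⟨k, hk⟩ := exists_nat_one_div_lt (half_pos hε)
  obtain ⟨C, hC⟩ := h1 k
  obtain ⟨C', hC'⟩ := h2 k
  obtain ⟨N, hN⟩ := exists_nat_gt (max (max C C' / (ε / 2)) 0)
  refine ⟨N, fun n hn => ?_⟩
  have hn' : (N : ℝ) ≤ n := by exact_mod_cast hn
  have hn0 : (0 : ℝ) < n := ((le_max_right _ _).trans_lt hN).trans_le hn'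
  have hCn : max C C' < n * (ε / 2) := by
    rw [← div_lt_iff₀ (half_pos hε)]
    exact ((le_max_left _ _).trans_lt hN).trans_le hn'
  have hneg : birkhoffSum T (fun x => -f x) n x = -birkhoffSum T f n x := by
    simp [birkhoffSum]
  have a1 := hC n
  have a2 := hC' n
  rw [hneg, integral_neg] at a2
  have b1 := le_max_left C C'
  have b2 := le_max_right C C'
  have b3 : (n : ℝ) * (1 / (k + 1)) ≤ n * (ε / 2) := by gcongr
  rw [Real.dist_eq, abs_lt]
  constructor
  · rw [neg_lt_sub_iff_lt_add, ← sub_lt_iff_lt_add', lt_div_iff₀ hn0]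
    nlinarith
  · rw [sub_lt_iff_lt_add, div_lt_iff₀ hn0]
    nlinarith

/-- Birkhoff sums of an integrable function over an ergodic map that tend to infinity grow
linearly. -/
theorem integral_pos_of_tendsto_birkhoffSum_atTop [IsProbabilityMeasure μ] (hT : Ergodic T μ)
    (hfm : Measurable f) (hf : Integrable f μ)
    (h : ∀ᵐ x ∂μ, Tendsto (fun n => birkhoffSum T f n x) atTop atTop) :
    0 < ∫ x, f x ∂μ := by
  have hSm : ∀ n, Measurable (birkhoffSum T f n) := fun n =>
    Finset.measurable_sum _ fun k _ => hfm.comp (hT.measurable.iterate k)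
  -- The infimum runs over times at least 1, so `I x > 0` means that the sums never return to the
  -- level 0.
  set I : α → ℝ := fun x => ⨅ n, birkhoffSum T f (n + 1) x with hI
  have hIm : Measurable I := Measurable.iInf fun n => hSm (n + 1)
  have hT' : ∀ {p : α → Prop}, (∀ᵐ x ∂μ, p x) → ∀ᵐ x ∂μ, ∀ k, p (T^[k] x) := fun hp =>
    ae_all_iff.2 fun k => (hT.toMeasurePreserving.iterate k).quasiMeasurePreserving.ae hp
  have hbdd : ∀ x, Tendsto (fun n => birkhoffSum T f n x) atTop atTop →
      BddBelow (Set.range fun n => birkhoffSum T f (n + 1) x) := fun x hx =>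
    bddBelow_range_of_tendsto_atTop_atTop ((tendsto_add_atTop_iff_nat 1).2 hx)
  have hle : ∀ x, Tendsto (fun n => birkhoffSum T f n x) atTop atTop → I x ≤ f x := by
    intro x hx
    simpa using ciInf_le (hbdd x hx) 0
  have hrec : ∀ x, Tendsto (fun n => birkhoffSum T f n x) atTop atTop →
      I x ≤ f x + min 0 (I (T x)) := by
    intro x hx
    rw [← sub_le_iff_le_add', le_min_iff]
    refine ⟨by linarith [hle x hx], le_ciInf fun n => ?_⟩
    have := ciInf_le (hbdd x hx) (n + 1)
    simp only [birkhoffSum_succ' T f (n + 1)] at this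
    linarith
  set g : α → ℝ := fun x => max 0 (I x) with hg
  have hgm : Measurable g := measurable_const.max hIm
  have hgi : Integrable g μ := by
    refine hf.mono hgm.aestronglyMeasurable ?_
    filter_upwards [h] with x hx
    rw [Real.norm_eq_abs, Real.norm_eq_abs, abs_of_nonneg (le_max_left _ _)]
    exact max_le (abs_nonneg _) ((hle x hx).trans (le_abs_self _))
  -- Since `I = g + min 0 I`, the recursion `hrec` bounds `g x` by `f x + min 0 (I (T x)) - min 0 (I
  -- x)`, which telescopes along the orbit.
  have hsum : ∀ᵐ x ∂μ, ∀ n, birkhoffSum T g n x + min 0 (I x) ≤ birkhoffSum T f n x := by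
    filter_upwards [hT' h] with x hx n
    have : birkhoffSum T g n x + min 0 (I x) ≤ birkhoffSum T f n x + min 0 (I (T^[n] x)) := by
      induction n with
      | zero => simp
      | succ n ih =>
        have h1 := hrec _ (hx n)
        rw [← Function.iterate_succ_apply' T] at h1
        have h2 : g (T^[n] x) + min 0 (I (T^[n] x)) = I (T^[n] x) := by
          simp [hg, max_add_min]
        rw [birkhoffSum_succ, birkhoffSum_succ]
        linarith
    exact this.trans (by linarith [min_le_left 0 (I (T^[n] x))])
  have hgpos : 0 < ∫ x, g x ∂μ := by
    -- If `g` vanished almost surely, every time would be followed by a later one with a sum at most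
    -- as large; the infimum is attained because the sums diverge. This contradicts the existence of
    -- a last time `K` at or below the starting level.
    refine lt_of_le_of_ne (integral_nonneg fun x => le_max_left _ _) fun h0 => ?_
    have hg0 := (integral_eq_zero_iff_of_nonneg (fun x => le_max_left _ _) hgi).1 h0.symm
    have hfalse : ∀ᵐ x ∂μ, False := by
      filter_upwards [h, hT' h, hT' hg0] with x hx hxT hx0
      have hex : ∀ k, ∃ j > k, birkhoffSum T f j x ≤ birkhoffSum T f k x := by
        intro k
        by_contra! hcon
        have ht := (tendsto_add_atTop_iff_nat 1).2 (hxT k)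
        rw [← Nat.cofinite_eq_atTop] at ht
        obtain ⟨m, hm⟩ := ht.exists_forall_le
        have h1 : birkhoffSum T f (m + 1) (T^[k] x) ≤ I (T^[k] x) := le_ciInf hm
        have h2 := hcon (k + (m + 1)) (by omega)
        rw [birkhoffSum_add] at h2
        have h3 : max 0 (I (T^[k] x)) = 0 := hx0 k
        have h4 := (le_max_right 0 (I (T^[k] x))).trans_eq h3
        linarith
      obtain ⟨N, hN⟩ := eventually_atTop.1 (hx.eventually_gt_atTop (birkhoffSum T f 0 x))
      have hlt : ∀ k, birkhoffSum T f k x ≤ birkhoffSum T f 0 x → k ≤ N := by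
        intro k hk
        by_contra! hcon
        exact absurd (hN k hcon.le) (not_lt.2 hk)
      classical
      set K := Nat.findGreatest (fun k => birkhoffSum T f k x ≤ birkhoffSum T f 0 x) N with hK
      have hKs : birkhoffSum T f K x ≤ birkhoffSum T f 0 x :=
        Nat.findGreatest_spec (P := fun k => birkhoffSum T f k x ≤ birkhoffSum T f 0 x)
          (Nat.zero_le N) le_rfl
      obtain ⟨j, hj, hjK⟩ := hex K
      exact absurd (Nat.le_findGreatest (hlt j (hjK.trans hKs)) (hjK.trans hKs)) (not_le.2 hj)
    simpa using hfalse.exists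
  obtain ⟨x, hx1, hx2, hx3⟩ := ((ae_tendsto_birkhoffSum_div hT hfm hf).and
    ((ae_tendsto_birkhoffSum_div hT hgm hgi).and hsum)).exists
  refine hgpos.trans_le ?_
  have h1 : Tendsto (fun n : ℕ => birkhoffSum T g n x / n + min 0 (I x) / n) atTop
      (𝓝 (∫ x, g x ∂μ + 0)) :=
    hx2.add (tendsto_const_nhds.div_atTop tendsto_natCast_atTop_atTop)
  rw [add_zero] at h1
  refine le_of_tendsto_of_tendsto' h1 hx1 fun n => ?_
  rw [← add_div]
  gcongr
  exact hx3 n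

end Ergodic

/-! ### Cylinder probabilities and the Markov property of the quenched walk -/

variable {d : ℕ}

/-- The trajectories that agree with `a` up to time `n`. -/
def cyl (n : ℕ) (a : ℕ → Lattice d) : Set (ℕ → Lattice d) := {X | ∀ i ≤ n, X i = a i}

lemma cyl_eq_preimage (n : ℕ) (a : ℕ → Lattice d) :
    cyl n a = Preorder.frestrictLe (π := fun _ => Lattice d) n ⁻¹'
      {Preorder.frestrictLe (π := fun _ => Lattice d) n a} := by
  ext X
  simp [cyl, funext_iff]

lemma measurableSet_cyl (n : ℕ) (a : ℕ → Lattice d) : MeasurableSet (cyl n a) := by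
  rw [cyl_eq_preimage]
  exact Preorder.measurable_frestrictLe n (measurableSet_singleton _)

/-- Finite measures on trajectories are determined by their values on cylinders. -/
lemma measure_ext_of_cyl {μ μ' : Measure (ℕ → Lattice d)} [IsFiniteMeasure μ]
    (h : ∀ n a, μ (cyl n a) = μ' (cyl n a)) : μ = μ' := by
  have hmap : ∀ n, μ.map (Preorder.frestrictLe (π := fun _ => Lattice d) n) =
      μ'.map (Preorder.frestrictLe (π := fun _ => Lattice d) n) := by
    intro n
    refine Measure.ext_of_singleton fun b => ?_
    -- Every finite history extends to a full trajectory; the value 0 after time `n` is arbitrary.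
    have hb : Preorder.frestrictLe (π := fun _ => Lattice d) n
        (fun i => if hi : i ≤ n then b ⟨i, Finset.mem_Iic.2 hi⟩ else 0) = b := by
      funext i
      simp [Finset.mem_Iic.1 i.2]
    rw [Measure.map_apply (by fun_prop) (measurableSet_singleton b),
      Measure.map_apply (by fun_prop) (measurableSet_singleton b), ← hb, ← cyl_eq_preimage]
    exact h _ _
  have hS : ∀ n (S : Set (Finset.Iic n → Lattice d)), MeasurableSet S →
      μ (Preorder.frestrictLe (π := fun _ => Lattice d) n ⁻¹' S) =
      μ' (Preorder.frestrictLe (π := fun _ => Lattice d) n ⁻¹' S) := by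
    intro n S hS
    rw [← Measure.map_apply (by fun_prop) hS, hmap, Measure.map_apply (by fun_prop) hS]
  refine ext_of_generate_finite _
    (generateFrom_measurableCylinders (α := fun _ : ℕ => Lattice d)).symm
    isPiSystem_measurableCylinders ?_ ?_
  · intro t ht
    obtain ⟨I, S, hS', rfl⟩ := (mem_measurableCylinders t).1 ht
    exact hS (I.sup id) (Finset.restrict₂ (π := fun _ => Lattice d) I.subset_Iic_sup_id ⁻¹' S)
      ((Finset.measurable_restrict₂ _) hS')
  · exact hS 0 Set.univ .univ

lemma quenchedLaw_cyl (x : Lattice d) (ω : Env d) (n : ℕ) (a : ℕ → Lattice d) :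
    quenchedLaw x ω (cyl n a) =
      Kernel.partialTraj (X := fun _ => Lattice d) (stepKernel ω) 0 n (fun _ => x)
        {Preorder.frestrictLe (π := fun _ => Lattice d) n a} := by
  rw [cyl_eq_preimage, ← Kernel.traj_map_frestrictLe,
    Kernel.map_apply' _ (by fun_prop) _ (measurableSet_singleton _)]
  rfl

lemma quenchedLaw_cyl_zero (x : Lattice d) (ω : Env d) (a : ℕ → Lattice d) :
    quenchedLaw x ω (cyl 0 a) = if a 0 = x then 1 else 0 := by
  rw [quenchedLaw_cyl, Kernel.partialTraj_zero, Kernel.deterministic_apply' _ _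
    (measurableSet_singleton _), Set.indicator_apply]
  congr 1
  rw [Set.mem_singleton_iff, eq_iff_iff]
  constructor
  · intro h
    exact (congrFun h ⟨0, by simp⟩).symm
  · intro h
    funext ⟨i, hi⟩
    obtain rfl : i = 0 := by simpa using hi
    exact h.symm

/-- As a function of the history `h`, the probability of completing it to `a` up to time `n + 1` is
supported on the single history `a` up to time `n`. -/
lemma quenchedLaw_cyl_succ (x : Lattice d) (ω : Env d) (n : ℕ) (a : ℕ → Lattice d) :
    quenchedLaw x ω (cyl (n + 1) a) =
      quenchedLaw x ω (cyl n a) * stepLaw ω (a n) {a (n + 1)} := by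
  rw [quenchedLaw_cyl, quenchedLaw_cyl]
  set b := Preorder.frestrictLe (π := fun _ => Lattice d) (n + 1) a
  have hI : Measurable (IicProdIoc (X := fun _ => Lattice d) n (n + 1)) := measurable_IicProdIoc
  have hs : MeasurableSet {b} := measurableSet_singleton b
  have hm : MeasurableSet (IicProdIoc (X := fun _ => Lattice d) n (n + 1) ⁻¹' {b}) := hI hs
  rw [Kernel.partialTraj_succ_of_le (Nat.zero_le n),
    Kernel.map_apply' _ hI _ hs, Kernel.comp_apply' _ _ _ hm]
  have := Kernel.IsMarkovKernel.map (stepKernel ω n)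
    (MeasurableEquiv.piSingleton (X := fun _ => Lattice d) n).measurable
  have key : ∀ h : Finset.Iic n → Lattice d,
      (Kernel.id ×ₖ ((stepKernel ω n).map
        (MeasurableEquiv.piSingleton (X := fun _ => Lattice d) n))) h
        (IicProdIoc (X := fun _ => Lattice d) n (n + 1) ⁻¹' {b}) =
      ({Preorder.frestrictLe (π := fun _ => Lattice d) n a} :
        Set (Finset.Iic n → Lattice d)).indicator (fun _ => stepLaw ω (a n) {a (n + 1)}) h := by
    intro h
    rw [Kernel.prod_apply, Kernel.id_apply, Measure.dirac_prod,
      Measure.map_apply measurable_prodMk_left hm,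
      Kernel.map_apply' _ (MeasurableEquiv.measurable _) _ (measurable_prodMk_left hm)]
    have hset : ∀ y, IicProdIoc (X := fun _ => Lattice d) n (n + 1)
          (h, MeasurableEquiv.piSingleton (X := fun _ => Lattice d) n y) = b ↔
        h = Preorder.frestrictLe (π := fun _ => Lattice d) n a ∧ y = a (n + 1) := by
      intro y
      constructor
      · intro hy
        refine ⟨funext fun i => ?_, ?_⟩
        · have := congrFun hy ⟨i.1, Finset.mem_Iic.2 ((Finset.mem_Iic.1 i.2).trans n.le_succ)⟩
          simpa [IicProdIoc, Finset.mem_Iic.1 i.2, b] using this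
        · have := congrFun hy ⟨n + 1, Finset.mem_Iic.2 le_rfl⟩
          simpa [IicProdIoc, b, MeasurableEquiv.piSingleton] using this
      · rintro ⟨rfl, rfl⟩
        funext i
        rcases Nat.le_succ_iff.1 (Finset.mem_Iic.1 i.2) with hi | hi
        · simp [IicProdIoc, hi, b]
        · obtain ⟨i, hi'⟩ := i
          obtain rfl : i = n + 1 := hi
          simp [IicProdIoc, b, MeasurableEquiv.piSingleton]
    by_cases hh : h = Preorder.frestrictLe (π := fun _ => Lattice d) n a
    · rw [Set.indicator_of_mem (by exact hh)]
      have : (MeasurableEquiv.piSingleton (X := fun _ => Lattice d) n) ⁻¹'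
          (Prod.mk h ⁻¹' (IicProdIoc (X := fun _ => Lattice d) n (n + 1) ⁻¹' {b})) =
          {a (n + 1)} := by
        ext y
        simpa [hh] using hset y
      rw [this, hh]
      rfl
    · rw [Set.indicator_of_notMem (by exact hh)]
      have : (MeasurableEquiv.piSingleton (X := fun _ => Lattice d) n) ⁻¹'
          (Prod.mk h ⁻¹' (IicProdIoc (X := fun _ => Lattice d) n (n + 1) ⁻¹' {b})) = ∅ := by
        ext y
        simpa [hh] using hset y
      rw [this, measure_empty]
  simp only [key]
  rw [lintegral_indicator (measurableSet_singleton _), setLIntegral_const, mul_comm]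

/-- The trajectory that starts at `0`, then follows `X` translated by `e`. -/
def prepend (e : Lattice d) (X : ℕ → Lattice d) : ℕ → Lattice d
  | 0 => 0
  | n + 1 => X n + e

lemma measurable_prepend (e : Lattice d) : Measurable (prepend e) := by
  refine measurable_pi_lambda _ fun n => ?_
  cases n with
  | zero => exact measurable_const
  | succ n =>
    have h : Measurable fun X : ℕ → Lattice d => X n := measurable_pi_apply n
    exact h.add_const e

lemma measurable_jumpProb (e : Jump d) : Measurable fun ω : Env d => ω 0 e :=
  (measurable_pi_apply e).comp (measurable_subtype_coe.comp (measurable_pi_apply 0))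

lemma sum_jumpProb (ω : Env d) (x : Lattice d) : ∑ e : Jump d, ENNReal.ofReal (ω x e) = 1 := by
  refine (ENNReal.ofReal_sum_of_nonneg fun e _ => (ω x).2.1 e).symm.trans ?_
  exact (congrArg ENNReal.ofReal (ω x).2.2).trans ENNReal.ofReal_one

lemma stepLaw_singleton (ω : Env d) (y z : Lattice d) :
    stepLaw ω y {z} = ∑ e : Jump d, if y + e.1 = z then ENNReal.ofReal (ω y e) else 0 := by
  simp [stepLaw, Set.indicator_apply]

lemma stepLaw_shift (ω : Env d) (e y z : Lattice d) :
    stepLaw (shift e ω) (y - e) {z - e} = stepLaw ω y {z} := by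
  rw [stepLaw_singleton, stepLaw_singleton]
  refine Finset.sum_congr rfl fun e' _ => ?_
  have h : y - e + e'.1 = z - e ↔ y + e'.1 = z := by
    rw [sub_add_eq_add_sub, sub_left_inj]
  simp only [h, shift, sub_add_cancel]

lemma prepend_preimage_cyl_succ {a : ℕ → Lattice d} (ha : a 0 = 0) (n : ℕ) (e : Lattice d) :
    prepend e ⁻¹' cyl (n + 1) a = cyl n fun k => a (k + 1) - e := by
  ext X
  constructor
  · intro h i hi
    exact eq_sub_of_add_eq (h (i + 1) (by omega))
  · intro h i hi
    cases i with
    | zero => exact ha.symm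
    | succ i => exact add_eq_of_eq_sub (h i (by omega))

lemma prepend_preimage_cyl_of_ne {a : ℕ → Lattice d} (ha : a 0 ≠ 0) (n : ℕ) (e : Lattice d) :
    prepend e ⁻¹' cyl n a = ∅ :=
  Set.eq_empty_of_forall_notMem fun _ h => ha (h 0 (Nat.zero_le n)).symm

/-- The Markov property of the quenched walk at time one. -/
theorem quenchedLaw_eq_sum (ω : Env d) :
    quenchedLaw 0 ω = ∑ e : Jump d, ENNReal.ofReal (ω 0 e) •
      (quenchedLaw 0 (shift e.1 ω)).map (prepend e.1) := by
  refine measure_ext_of_cyl fun n a => ?_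
  simp only [Measure.coe_finsetSum, Finset.sum_apply, Measure.smul_apply, smul_eq_mul,
    Measure.map_apply (measurable_prepend _) (measurableSet_cyl n a)]
  by_cases ha : a 0 = 0
  · cases n with
    | zero =>
      have : ∀ e : Lattice d, prepend e ⁻¹' cyl 0 a = Set.univ := by
        intro e
        ext X
        simp [cyl, prepend, ha]
      simp [this, quenchedLaw_cyl_zero, ha, sum_jumpProb]
    | succ n =>
      simp only [prepend_preimage_cyl_succ ha]
      -- Each step after the first multiplies both sides by the same factor, since the translated
      -- environment seen from the translated position has the same step law.
      induction n with
      | zero =>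
        rw [quenchedLaw_cyl_succ, quenchedLaw_cyl_zero, if_pos ha, one_mul, stepLaw_singleton, ha]
        refine Finset.sum_congr rfl fun e _ => ?_
        rw [quenchedLaw_cyl_zero]
        simp [sub_eq_zero, eq_comm]
      | succ n ih =>
        rw [quenchedLaw_cyl_succ, ih, Finset.sum_mul]
        refine Finset.sum_congr rfl fun e _ => ?_
        rw [quenchedLaw_cyl_succ _ _ n, stepLaw_shift, mul_assoc]
  · have h : quenchedLaw 0 ω (cyl n a) = 0 := by
      refine measure_mono_null (t := cyl 0 a) (fun X hX i hi => hX i (by omega)) ?_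
      rw [quenchedLaw_cyl_zero, if_neg ha]
    simp [prepend_preimage_cyl_of_ne ha, h]

lemma ae_quenchedLaw_zero (x : Lattice d) (ω : Env d) : ∀ᵐ X ∂(quenchedLaw x ω), X 0 = x := by
  have : quenchedLaw x ω (cyl 0 fun _ => x) = 1 := by simp [quenchedLaw_cyl_zero]
  filter_upwards [(mem_ae_iff_prob_eq_one (measurableSet_cyl _ _)).2 this] with X hX
  exact hX 0 le_rfl

lemma lintegral_quenchedLaw (ω : Env d) {g : (ℕ → Lattice d) → ℝ≥0∞} (hg : Measurable g) :
    ∫⁻ X, g X ∂(quenchedLaw 0 ω) = ∑ e : Jump d, ENNReal.ofReal (ω 0 e) *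
      ∫⁻ X, g (prepend e.1 X) ∂(quenchedLaw 0 (shift e.1 ω)) := by
  conv_lhs => rw [quenchedLaw_eq_sum]
  simp [lintegral_smul_measure, lintegral_map hg (measurable_prepend _)]

/-! ### Translations and the environment viewed from the particle -/

lemma measurable_shift (y : Lattice d) : Measurable (shift (d := d) y) :=
  measurable_pi_lambda _ fun x => measurable_pi_apply (x + y)

lemma shift_zero (ω : Env d) : shift 0 ω = ω := by
  funext x
  simp [shift]

lemma shift_shift (x y : Lattice d) (ω : Env d) : shift x (shift y ω) = shift (x + y) ω := by
  funext z
  simp [shift, add_assoc]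

/-- The jumps generate the lattice as a monoid. -/
lemma mem_of_jump_mem {S : AddSubmonoid (Lattice d)} (hjump : ∀ e : Jump d, e.1 ∈ S)
    (x : Lattice d) : x ∈ S := by
  have hsingle : ∀ (i : Fin d) (s : ℤ), |s| = 1 → (Pi.single i s : Lattice d) ∈ S := by
    intro i s hs
    refine hjump ⟨Pi.single i s, ?_⟩
    rw [Finset.sum_eq_single i] <;> simp +contextual [hs]
  rw [← Finset.univ_sum_single x]
  refine sum_mem fun i _ => ?_
  obtain ⟨n, hn | hn⟩ := Int.eq_nat_or_neg (x i)
  · have : (Pi.single i (x i) : Lattice d) = n • Pi.single i 1 := by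
      rw [hn, ← Pi.single_smul]; simp
    rw [this]
    exact nsmul_mem (hsingle i 1 (by simp)) n
  · have : (Pi.single i (x i) : Lattice d) = n • Pi.single i (-1) := by
      rw [hn, ← Pi.single_smul]; simp
    rw [this]
    exact nsmul_mem (hsingle i (-1) (by simp)) n

lemma jumpProb_nonneg (ω : Env d) (x : Lattice d) (e : Jump d) : 0 ≤ ω x e := (ω x).2.1 e

lemma sum_jumpProb_eq_one (ω : Env d) (x : Lattice d) : ∑ e : Jump d, ω x e = 1 := (ω x).2.2

lemma jumpProb_le_one (ω : Env d) (x : Lattice d) (e : Jump d) : ω x e ≤ 1 := by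
  rw [← sum_jumpProb_eq_one ω x]
  exact Finset.single_le_sum (f := fun e => ω x e) (fun i _ => jumpProb_nonneg ω x i)
    (Finset.mem_univ e)

/-- The law of the environment seen from the particle after one step, started from `ν`. -/
noncomputable def envStep (ν : Measure (Env d)) : Measure (Env d) :=
  ∑ e : Jump d, (ν.withDensity fun ω => ENNReal.ofReal (ω 0 e)).map (shift e.1)

lemma lintegral_envStep (ν : Measure (Env d)) {g : Env d → ℝ≥0∞} (hg : Measurable g) :
    ∫⁻ ω, g ω ∂(envStep ν) =
      ∫⁻ ω, ∑ e : Jump d, ENNReal.ofReal (ω 0 e) * g (shift e.1 ω) ∂ν := by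
  have hm : ∀ e : Jump d, Measurable fun ω : Env d => ENNReal.ofReal (ω 0 e) := fun e =>
    (measurable_jumpProb e).ennreal_ofReal
  have hgs : ∀ e : Jump d, Measurable fun ω : Env d => g (shift e.1 ω) := fun e =>
    hg.comp (measurable_shift _)
  have hmul : ∀ e ∈ Finset.univ, Measurable fun ω : Env d =>
      ENNReal.ofReal (ω 0 e) * g (shift e.1 ω) := fun e _ => (hm e).mul (hgs e)
  rw [envStep, lintegral_finsetSum_measure, lintegral_finsetSum _ hmul]
  refine Finset.sum_congr rfl fun e _ => ?_
  rw [lintegral_map hg (measurable_shift _), lintegral_withDensity_eq_lintegral_mul _ (hm e) (hgs e)]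
  rfl

instance isProbabilityMeasure_envStep (ν : Measure (Env d)) [IsProbabilityMeasure ν] :
    IsProbabilityMeasure (envStep ν) := by
  constructor
  rw [← lintegral_one, lintegral_envStep ν measurable_const]
  simp [sum_jumpProb]

lemma integral_envStep (ν : Measure (Env d)) [IsProbabilityMeasure ν] {f : Env d → ℝ}
    (hf : Measurable f) {C : ℝ} (hC : ∀ ω, |f ω| ≤ C) :
    ∫ ω, f ω ∂(envStep ν) = ∫ ω, envOp f ω ∂ν := by
  have hm : ∀ e : Jump d, Measurable fun ω : Env d => ENNReal.ofReal (ω 0 e) := fun e =>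
    (measurable_jumpProb e).ennreal_ofReal
  have hfs : ∀ e : Jump d, Measurable fun ω : Env d => f (shift e.1 ω) := fun e =>
    hf.comp (measurable_shift _)
  have hle : ∀ (e : Jump d) (ω : Env d), |ω 0 e * f (shift e.1 ω)| ≤ C := by
    intro e ω
    rw [abs_mul, abs_of_nonneg (jumpProb_nonneg ω 0 e)]
    exact (mul_le_of_le_one_left (abs_nonneg _) (jumpProb_le_one ω 0 e)).trans (hC _)
  have hint : Integrable f (envStep ν) :=
    Integrable.of_bound hf.aestronglyMeasurable C (ae_of_all _ hC)
  rw [envStep, integrable_finsetSum_measure] at hint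
  rw [envStep, integral_finsetSum_measure hint]
  have hmul : ∀ e ∈ Finset.univ, Integrable (fun ω : Env d => ω 0 e * f (shift e.1 ω)) ν :=
    fun e _ => Integrable.of_bound
      ((measurable_jumpProb e).mul (hfs e)).aestronglyMeasurable C (ae_of_all _ (hle e))
  unfold envOp
  rw [integral_finsetSum _ hmul]
  refine Finset.sum_congr rfl fun e _ => ?_
  rw [integral_map (measurable_shift _).aemeasurable hf.aestronglyMeasurable,
    integral_withDensity_eq_integral_toReal_smul (hm e) (ae_of_all _ fun _ => ENNReal.ofReal_lt_top)]
  refine integral_congr_ae (ae_of_all _ fun ω => ?_)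
  simp [ENNReal.toReal_ofReal (jumpProb_nonneg ω 0 e)]

/-- Bounded continuous functions separate finite measures, so invariance against them upgrades to an
equality of measures, usable with any measurable test function. -/
lemma IsEnvInvariant.envStep_eq {ν : Measure (Env d)} [IsProbabilityMeasure ν]
    (hν : IsEnvInvariant ν) : envStep ν = ν := by
  refine ext_of_forall_integral_eq_of_IsFiniteMeasure fun f => ?_
  rw [integral_envStep ν f.continuous.measurable f.norm_coe_le_norm, hν f]

/-! ### Quasi-invariance under translations, equivalence of ν and `P`, harmonic functions -/

section Quasi

variable {ν : Measure (Env d)}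

lemma measurableSet_forall_shift {s : Set (Env d)} (hs : MeasurableSet s) :
    MeasurableSet {ω | ∀ x, shift x ω ∈ s} := by
  rw [Set.ofPred_forall]
  exact MeasurableSet.iInter fun x => measurable_shift x hs

lemma shift_preimage_forall_shift (s : Set (Env d)) (y : Lattice d) :
    shift y ⁻¹' {ω | ∀ x, shift x ω ∈ s} = {ω | ∀ x, shift x ω ∈ s} := by
  ext ω
  constructor
  · intro h x
    have := h (x - y)
    rwa [shift_shift, sub_add_cancel] at this
  · intro h x
    rw [shift_shift]
    exact h _

/-- A measurable function that is almost surely invariant under all translations is almost surely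
constant. -/
theorem exists_ae_eq_const_of_shift {P : Measure (Env d)} [IsProbabilityMeasure P]
    (hErg : IsTotallyErgodic P) (hac : ν ≪ P) {h : Env d → ℝ} (hm : Measurable h)
    (hinv : ∀ᵐ ω ∂ν, ∀ x, h (shift x ω) = h ω) : ∃ c, ∀ᵐ ω ∂ν, h ω = c := by
  refine exists_eventuallyEq_const_of_forall_separating MeasurableSet fun U hU => ?_
  -- The preimage of `U` is only almost surely invariant; requiring all translates to lie in it
  -- gives an exactly invariant event, as ergodicity demands.
  have hA := measurableSet_forall_shift (hm hU)
  rcases hErg _ hA (shift_preimage_forall_shift _) with h0 | h1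
  · right
    filter_upwards [measure_eq_zero_iff_ae_notMem.1 (hac h0), hinv] with ω h1 h2 h3
    exact h1 fun x => by simpa [h2 x] using h3
  · left
    filter_upwards [hac.ae_le ((mem_ae_iff_prob_eq_one hA).2 h1)] with ω hω
    have := hω 0
    rwa [shift_zero] at this

variable [IsProbabilityMeasure ν]

/-- By stationarity, the mass of `s` is the integral of a sum of nonnegative terms, one per jump. If
it is zero, every term vanishes almost surely, and the positive weight `ω 0 e` can be cancelled. -/
lemma quasiMeasurePreserving_shift_jump (hν : IsEnvInvariant ν)
    (hE : ∀ᵐ ω ∂ν, ∀ e : Jump d, 0 < ω 0 e) (e : Jump d) :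
    Measure.QuasiMeasurePreserving (shift e.1) ν ν := by
  refine ⟨measurable_shift _, Measure.AbsolutelyContinuous.mk fun s hs h0 => ?_⟩
  rw [Measure.map_apply (measurable_shift _) hs]
  have h1 : ∫⁻ ω, ∑ e : Jump d, ENNReal.ofReal (ω 0 e) * s.indicator 1 (shift e.1 ω) ∂ν = 0 := by
    rw [← lintegral_envStep ν (measurable_one.indicator hs), hν.envStep_eq,
      lintegral_indicator_one hs, h0]
  have hmeas : Measurable fun ω : Env d =>
      ∑ e : Jump d, ENNReal.ofReal (ω 0 e) * s.indicator (1 : Env d → ℝ≥0∞) (shift e.1 ω) :=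
    Finset.measurable_sum _ fun e _ => (measurable_jumpProb e).ennreal_ofReal.mul
      ((measurable_one.indicator hs).comp (measurable_shift _))
  have h2 := (lintegral_eq_zero_iff hmeas).1 h1
  rw [measure_eq_zero_iff_ae_notMem]
  filter_upwards [h2, hE] with ω hω hpos hmem
  have := (Finset.sum_eq_zero_iff.1 hω) e (Finset.mem_univ e)
  have hmem' : shift e.1 ω ∈ s := hmem
  rw [Set.indicator_of_mem hmem', Pi.one_apply, mul_one, ENNReal.ofReal_eq_zero] at this
  exact absurd (hpos e) (not_lt.2 this)

lemma quasiMeasurePreserving_shift (hν : IsEnvInvariant ν)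
    (hE : ∀ᵐ ω ∂ν, ∀ e : Jump d, 0 < ω 0 e) (x : Lattice d) :
    Measure.QuasiMeasurePreserving (shift x) ν ν := by
  let S : AddSubmonoid (Lattice d) :=
    { carrier := {x | Measure.QuasiMeasurePreserving (shift x) ν ν}
      zero_mem' := by
        have : shift (0 : Lattice d) = id := funext shift_zero
        change Measure.QuasiMeasurePreserving (shift 0) ν ν
        rw [this]
        exact .id ν
      add_mem' := by
        intro x y hx hy
        have : shift (x + y) = shift x ∘ shift y := funext fun ω => (shift_shift x y ω).symm
        change Measure.QuasiMeasurePreserving (shift (x + y)) ν ν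
        rw [this]
        exact Measure.QuasiMeasurePreserving.comp hx hy }
  exact mem_of_jump_mem (S := S) (quasiMeasurePreserving_shift_jump hν hE) x

lemma ae_forall_shift (hν : IsEnvInvariant ν) (hE : ∀ᵐ ω ∂ν, ∀ e : Jump d, 0 < ω 0 e)
    {p : Env d → Prop} (hp : ∀ᵐ ω ∂ν, p ω) : ∀ᵐ ω ∂ν, ∀ x, p (shift x ω) :=
  ae_all_iff.2 fun x => (quasiMeasurePreserving_shift hν hE x).ae hp

/-- An invariant measure of the environment chain that is absolutely continuous with respect to an
ergodic elliptic law is equivalent to it. -/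
theorem absolutelyContinuous_of_isEnvInvariant {P : Measure (Env d)} [IsProbabilityMeasure P]
    (hErg : IsTotallyErgodic P) (hν : IsEnvInvariant ν) (hac : ν ≪ P)
    (hE : ∀ᵐ ω ∂ν, ∀ e : Jump d, 0 < ω 0 e) : P ≪ ν := by
  refine Measure.AbsolutelyContinuous.mk fun s hs h0 => ?_
  -- The environments with no translate in `s` form an invariant event of full ν-measure. Since `ν ≪
  -- P`, its `P`-probability is not 0, hence it is 1.
  have hA := measurableSet_forall_shift hs.compl
  have h1 : ∀ᵐ ω ∂ν, ω ∈ {ω | ∀ x, shift x ω ∈ sᶜ} :=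
    ae_forall_shift hν hE (measure_eq_zero_iff_ae_notMem.1 h0)
  rcases hErg _ hA (shift_preimage_forall_shift _) with h | h
  · have := measure_eq_zero_iff_ae_notMem.1 (hac h)
    obtain ⟨ω, h2, h3⟩ := (h1.and this).exists
    exact absurd h2 h3
  · have h2 := (mem_ae_iff_prob_eq_one hA).2 h
    rw [measure_eq_zero_iff_ae_notMem]
    filter_upwards [h2] with ω hω
    have := hω 0
    rwa [shift_zero] at this

/-- Almost surely along the orbit, bounded harmonic functions of the environment chain are constant
under a stationary law. -/
theorem ae_shift_eq_of_harmonic (hν : IsEnvInvariant ν)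
    (hE : ∀ᵐ ω ∂ν, ∀ e : Jump d, 0 < ω 0 e) {h : Env d → ℝ} (hm : Measurable h) {C : ℝ}
    (hC : ∀ ω, |h ω| ≤ C) (hharm : ∀ ω, envOp h ω = h ω) :
    ∀ᵐ ω ∂ν, ∀ e : Jump d, h (shift e.1 ω) = h ω := by
  have hsqm : Measurable fun ω => h ω ^ 2 := hm.pow_const 2
  have hsqC : ∀ ω, |h ω ^ 2| ≤ C ^ 2 := by
    intro ω
    rw [abs_pow]
    exact pow_le_pow_left₀ (abs_nonneg _) (hC ω) 2
  -- For harmonic `h`, the one-step variance is `R(h²) - h²`, whose ν-integral vanishes by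
  -- stationarity.
  have hvar : ∀ ω, ∑ e : Jump d, ω 0 e * (h (shift e.1 ω) - h ω) ^ 2 =
      envOp (fun ω => h ω ^ 2) ω - h ω ^ 2 := by
    intro ω
    have h1 : ∑ e : Jump d, ω 0 e = 1 := sum_jumpProb_eq_one ω 0
    have h2 : ∑ e : Jump d, ω 0 e * h (shift e.1 ω) = h ω := hharm ω
    have h3 : ∀ e : Jump d, ω 0 e * (h (shift e.1 ω) - h ω) ^ 2 =
        ω 0 e * h (shift e.1 ω) ^ 2 - 2 * h ω * (ω 0 e * h (shift e.1 ω)) + h ω ^ 2 * ω 0 e :=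
      fun e => by ring
    simp only [h3, Finset.sum_add_distrib, Finset.sum_sub_distrib, ← Finset.mul_sum, h1, h2, envOp]
    ring
  have hopm : Measurable (envOp fun ω => h ω ^ 2) :=
    Finset.measurable_sum _ fun e _ => (measurable_jumpProb e).mul
      (hsqm.comp (measurable_shift e.1))
  have hopC : ∀ ω, |envOp (fun ω => h ω ^ 2) ω| ≤ C ^ 2 := by
    intro ω
    calc |envOp (fun ω => h ω ^ 2) ω| ≤ ∑ e : Jump d, |ω 0 e * h (shift e.1 ω) ^ 2| :=
          Finset.abs_sum_le_sum_abs _ _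
      _ ≤ ∑ e : Jump d, ω 0 e * C ^ 2 := by
          refine Finset.sum_le_sum fun e _ => ?_
          rw [abs_mul, abs_of_nonneg (jumpProb_nonneg ω 0 e)]
          exact mul_le_mul_of_nonneg_left (hsqC _) (jumpProb_nonneg ω 0 e)
      _ = C ^ 2 := by rw [← Finset.sum_mul, sum_jumpProb_eq_one, one_mul]
  have hi1 : Integrable (envOp fun ω => h ω ^ 2) ν :=
    .of_bound hopm.aestronglyMeasurable (C ^ 2) (ae_of_all _ hopC)
  have hi2 : Integrable (fun ω => h ω ^ 2) ν :=
    .of_bound hsqm.aestronglyMeasurable (C ^ 2) (ae_of_all _ hsqC)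
  have hzero : ∫ ω, ∑ e : Jump d, ω 0 e * (h (shift e.1 ω) - h ω) ^ 2 ∂ν = 0 := by
    simp only [hvar]
    rw [integral_sub hi1 hi2, ← integral_envStep ν hsqm hsqC, hν.envStep_eq, sub_self]
  have hnn : ∀ (ω : Env d) (e : Jump d), 0 ≤ ω 0 e * (h (shift e.1 ω) - h ω) ^ 2 :=
    fun ω e => mul_nonneg (jumpProb_nonneg ω 0 e) (sq_nonneg _)
  rw [integral_eq_zero_iff_of_nonneg (fun ω => Finset.sum_nonneg fun e _ => hnn ω e)
    (by simp only [hvar]; exact hi1.sub hi2)] at hzero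
  filter_upwards [hzero, hE] with ω hω hpos e
  have := (Finset.sum_eq_zero_iff_of_nonneg fun e _ => hnn ω e).1 hω e (Finset.mem_univ e)
  rcases mul_eq_zero.1 this with h0 | h0
  · exact absurd (hpos e) (by rw [h0]; exact lt_irrefl 0)
  · exact sub_eq_zero.1 (pow_eq_zero_iff two_ne_zero |>.1 h0)

end Quasi

/-! ### The joint process of environment and walk -/

/-- One step of the walk: the environment and the remaining trajectory seen from the particle. -/
def walkShift (p : Env d × (ℕ → Lattice d)) : Env d × (ℕ → Lattice d) :=
  (shift (p.2 1) p.1, fun n => p.2 (n + 1) - p.2 1)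

lemma measurable_eval_traj (n : ℕ) : Measurable fun X : ℕ → Lattice d => X n :=
  measurable_pi_apply n

lemma measurable_walkShift : Measurable (walkShift (d := d)) := by
  have h1 : Measurable fun q : Env d × Lattice d => shift q.2 q.1 :=
    measurable_from_prod_countable_left fun y => measurable_shift y
  have h2 : Measurable fun p : Env d × (ℕ → Lattice d) => (p.1, p.2 1) :=
    measurable_fst.prodMk ((measurable_eval_traj 1).comp measurable_snd)
  refine (h1.comp h2).prodMk (measurable_pi_lambda _ fun n => ?_)
  exact ((measurable_eval_traj (n + 1)).comp measurable_snd).sub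
    ((measurable_eval_traj 1).comp measurable_snd)

lemma walkShift_prepend (ω : Env d) (e : Lattice d) {X : ℕ → Lattice d} (hX : X 0 = 0) :
    walkShift (ω, prepend e X) = (shift e ω, X) := by
  refine Prod.ext ?_ ?_
  · simp [walkShift, prepend, hX]
  · funext n
    simp [walkShift, prepend, hX]

instance isProbabilityMeasure_jointLaw (ν : Measure (Env d)) [IsProbabilityMeasure ν]
    (x : Lattice d) : IsProbabilityMeasure (jointLaw ν x) := by
  unfold jointLaw
  infer_instance

lemma lintegral_jointLaw (ν : Measure (Env d)) [IsProbabilityMeasure ν] (x : Lattice d)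
    {g : Env d × (ℕ → Lattice d) → ℝ≥0∞} (hg : Measurable g) :
    ∫⁻ p, g p ∂(jointLaw ν x) = ∫⁻ ω, ∫⁻ X, g (ω, X) ∂(quenchedLaw x ω) ∂ν :=
  Measure.lintegral_compProd hg

/-- By the Markov property at time one, integrating `g ∘ walkShift` amounts to averaging the
quenched integral of `g` over the environment after one step, whose law is again ν. -/
theorem measurePreserving_walkShift {ν : Measure (Env d)} [IsProbabilityMeasure ν]
    (hν : IsEnvInvariant ν) :
    MeasurePreserving walkShift (jointLaw ν 0) (jointLaw ν 0) := by
  refine ⟨measurable_walkShift, Measure.ext_of_lintegral _ fun g hg => ?_⟩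
  have hG : Measurable fun ω : Env d => ∫⁻ X, g (ω, X) ∂(quenchedLaw 0 ω) :=
    hg.lintegral_kernel_prod_right' (κ := quenchedKernel (d := d) 0)
  rw [lintegral_map hg measurable_walkShift,
    lintegral_jointLaw ν 0 (g := fun p => g (walkShift p)) (hg.comp measurable_walkShift),
    lintegral_jointLaw ν 0 hg]
  conv_rhs => rw [← hν.envStep_eq]
  rw [lintegral_envStep ν hG]
  refine lintegral_congr fun ω => ?_
  rw [lintegral_quenchedLaw ω (g := fun X => g (walkShift (ω, X)))
    (hg.comp (measurable_walkShift.comp measurable_prodMk_left))]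
  refine Finset.sum_congr rfl fun e _ => ?_
  congr 1
  refine lintegral_congr_ae ?_
  filter_upwards [ae_quenchedLaw_zero 0 (shift e.1 ω)] with X hX
  rw [walkShift_prepend ω e.1 hX]

/-! ### Ergodicity of the joint process -/

section Invariant

variable {A : Set (Env d × (ℕ → Lattice d))}

/-- `walkShift` sends `(ω, prepend e X)` to `(shift e ω, X)` when `X 0 = 0`, so invariance of `A`
lets the Markov property pass through the intersection. -/
lemma quenchedLaw_inter_section (hA : MeasurableSet A) (hinv : walkShift ⁻¹' A = A)
    {s : Set (ℕ → Lattice d)} (hs : MeasurableSet s) (ω : Env d) :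
    quenchedLaw 0 ω (s ∩ Prod.mk ω ⁻¹' A) = ∑ e : Jump d, ENNReal.ofReal (ω 0 e) *
      quenchedLaw 0 (shift e.1 ω) (prepend e.1 ⁻¹' s ∩ Prod.mk (shift e.1 ω) ⁻¹' A) := by
  have hm : MeasurableSet (s ∩ Prod.mk ω ⁻¹' A) := hs.inter (measurable_prodMk_left hA)
  conv_lhs => rw [quenchedLaw_eq_sum]
  simp only [Measure.coe_finsetSum, Finset.sum_apply, Measure.smul_apply, smul_eq_mul,
    Measure.map_apply (measurable_prepend _) hm]
  refine Finset.sum_congr rfl fun e _ => ?_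
  congr 1
  refine measure_congr ?_
  filter_upwards [ae_quenchedLaw_zero 0 (shift e.1 ω)] with X hX
  have h : (ω, prepend e.1 X) ∈ A ↔ (shift e.1 ω, X) ∈ A := by
    rw [← walkShift_prepend ω e.1 hX]
    exact (Set.ext_iff.1 hinv _).symm
  exact propext (and_congr Iff.rfl h)

/-- If the conditional probability of an invariant event is the same in all translates of an
environment, then that event is independent of the walk in this environment. -/
lemma quenchedLaw_cyl_inter_section (hA : MeasurableSet A) (hinv : walkShift ⁻¹' A = A)
    {c : ℝ≥0∞} (n : ℕ) : ∀ (a : ℕ → Lattice d) (ω : Env d),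
      (∀ x, quenchedLaw 0 (shift x ω) (Prod.mk (shift x ω) ⁻¹' A) = c) →
      quenchedLaw 0 ω (cyl n a ∩ Prod.mk ω ⁻¹' A) = c * quenchedLaw 0 ω (cyl n a) := by
  induction n with
  | zero =>
    intro a ω hω
    rw [quenchedLaw_cyl_zero]
    by_cases ha : a 0 = 0
    · have h0 := hω 0
      rw [shift_zero] at h0
      rw [if_pos ha, mul_one, ← h0]
      refine measure_congr ?_
      filter_upwards [ae_quenchedLaw_zero 0 ω] with X hX
      refine propext (and_iff_right fun i hi => ?_)
      rw [Nat.le_zero.1 hi, hX, ha]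
    · rw [if_neg ha, mul_zero]
      refine measure_mono_null Set.inter_subset_left ?_
      rw [quenchedLaw_cyl_zero, if_neg ha]
  | succ n ih =>
    intro a ω hω
    -- With the full event, this splits the plain cylinder probability by the same first jump. The
    -- hypothesis on all translates is inherited by `shift e ω`, so induction applies term by term.
    have hcyl := quenchedLaw_inter_section (A := Set.univ) .univ rfl (measurableSet_cyl (n + 1) a) ω
    simp only [Set.preimage_univ, Set.inter_univ] at hcyl
    rw [quenchedLaw_inter_section hA hinv (measurableSet_cyl _ _), hcyl, Finset.mul_sum]
    refine Finset.sum_congr rfl fun e _ => ?_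
    by_cases ha : a 0 = 0
    · rw [prepend_preimage_cyl_succ ha, ih _ _ fun x => ?_]
      · ring
      · rw [shift_shift]
        exact hω _
    · simp [prepend_preimage_cyl_of_ne ha]

/-- The environment and walk seen from the particle are ergodic. -/
theorem ergodic_walkShift {P ν : Measure (Env d)} [IsProbabilityMeasure P]
    [IsProbabilityMeasure ν] (hErg : IsTotallyErgodic P) (hν : IsEnvInvariant ν) (hac : ν ≪ P)
    (hE : ∀ᵐ ω ∂ν, ∀ e : Jump d, 0 < ω 0 e) : Ergodic walkShift (jointLaw ν 0) := by
  refine ⟨measurePreserving_walkShift hν, ⟨fun A hA hinv => ?_⟩⟩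
  set h : Env d → ℝ := fun ω => (quenchedLaw 0 ω).real (Prod.mk ω ⁻¹' A) with hh
  have hm : Measurable h :=
    (Kernel.measurable_kernel_prodMk_left (κ := quenchedKernel (d := d) 0) hA).ennreal_toReal
  have hbound : ∀ ω, |h ω| ≤ 1 := fun ω => by
    rw [abs_of_nonneg measureReal_nonneg]
    exact measureReal_le_one
  have hharm : ∀ ω, envOp h ω = h ω := by
    intro ω
    have := quenchedLaw_inter_section hA hinv .univ ω
    simp only [Set.preimage_univ, Set.univ_inter] at this
    rw [hh]
    simp only [Measure.real]
    rw [this, ENNReal.toReal_sum fun e _ => ENNReal.mul_ne_top ENNReal.ofReal_ne_top (by finiteness)]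
    refine Finset.sum_congr rfl fun e _ => ?_
    rw [ENNReal.toReal_mul, ENNReal.toReal_ofReal (jumpProb_nonneg ω 0 e)]
  have hjump := ae_shift_eq_of_harmonic hν hE hm hbound hharm
  have hall : ∀ᵐ ω ∂ν, ∀ x, h (shift x ω) = h ω := by
    filter_upwards [ae_forall_shift hν hE hjump] with ω hω
    -- Demanding the identity at every base point `y` makes these periods closed under addition, so
    -- it suffices that the jumps are periods.
    let S : AddSubmonoid (Lattice d) :=
      { carrier := {x | ∀ y, h (shift (x + y) ω) = h (shift y ω)}
        zero_mem' := fun y => by rw [zero_add]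
        add_mem' := fun {x x'} hx hx' y => by rw [add_assoc, hx, hx'] }
    have hS : ∀ e : Jump d, e.1 ∈ S := fun e y => by
      rw [← shift_shift]
      exact hω y e
    intro x
    have := mem_of_jump_mem hS x 0
    rwa [add_zero, shift_zero] at this
  obtain ⟨c, hc⟩ := exists_ae_eq_const_of_shift hErg hac hm hall
  have hc' : ∀ᵐ ω ∂ν, ∀ x, quenchedLaw 0 (shift x ω) (Prod.mk (shift x ω) ⁻¹' A) =
      ENNReal.ofReal c := by
    filter_upwards [ae_forall_shift hν hE hc] with ω hω x
    rw [← hω x, hh, ofReal_measureReal]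
  have hzo : ∀ᵐ ω ∂ν, quenchedLaw 0 ω (Prod.mk ω ⁻¹' A) = ENNReal.ofReal c ∧
      ENNReal.ofReal c * quenchedLaw 0 ω (Prod.mk ω ⁻¹' A)ᶜ = 0 := by
    filter_upwards [hc'] with ω hω
    have hAω : MeasurableSet (Prod.mk ω ⁻¹' A) := measurable_prodMk_left hA
    have heq : (quenchedLaw 0 ω).restrict (Prod.mk ω ⁻¹' A) =
        ENNReal.ofReal c • quenchedLaw 0 ω := by
      refine measure_ext_of_cyl fun n a => ?_
      rw [Measure.restrict_apply (measurableSet_cyl n a),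
        quenchedLaw_cyl_inter_section hA hinv n a ω hω]
      rfl
    refine ⟨by simpa [shift_zero] using hω 0, ?_⟩
    -- Independence from all cylinders extends to all events; tested on the complement of `A`, it
    -- gives the zero-one law.
    have := congrArg (fun m => m (Prod.mk ω ⁻¹' A)ᶜ) heq
    simp only [Measure.restrict_apply hAω.compl, Set.compl_inter_self, measure_empty,
      Measure.smul_apply, smul_eq_mul] at this
    exact this.symm
  refine eventuallyConst_set.2 ?_
  by_cases hc0 : ENNReal.ofReal c = 0
  · right
    refine Measure.ae_compProd_of_ae_ae hA.compl ?_
    filter_upwards [hzo] with ω hω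
    exact measure_eq_zero_iff_ae_notMem.1 (hω.1.trans hc0)
  · left
    refine Measure.ae_compProd_of_ae_ae hA ?_
    filter_upwards [hzo] with ω hω
    exact measure_eq_zero_iff_ae_notMem.1 ((mul_eq_zero.1 hω.2).resolve_left hc0) |>.mono
      fun X hX => not_not.1 hX

end Invariant

/-! ### Displacement as a Birkhoff sum and its mean -/

section Velocity

variable (l : EuclideanSpace ℝ (Fin d))

/-- The component in direction `l` of the first increment of the walk. -/
noncomputable def increment (p : Env d × (ℕ → Lattice d)) : ℝ :=
  inner ℝ (toEuclidean (p.2 1 - p.2 0)) l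

lemma measurable_increment : Measurable (increment l) :=
  (measurable_of_countable fun y : Lattice d => inner ℝ (toEuclidean y) l).comp
    (((measurable_eval_traj 1).comp measurable_snd).sub
      ((measurable_eval_traj 0).comp measurable_snd))

lemma toEuclidean_add (x y : Lattice d) :
    toEuclidean (x + y) = toEuclidean x + toEuclidean y := by
  ext i
  simp [toEuclidean]

/-- Recentring leaves increments of the trajectory unchanged, so the sum telescopes. -/
lemma birkhoffSum_increment (n : ℕ) (p : Env d × (ℕ → Lattice d)) :
    birkhoffSum walkShift (increment l) n p = inner ℝ (toEuclidean (p.2 n - p.2 0)) l := by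
  induction n generalizing p with
  | zero =>
    have : toEuclidean (0 : Lattice d) = 0 := by ext i; simp [toEuclidean]
    simp [this]
  | succ n ih =>
    rw [birkhoffSum_succ', ih, increment, ← inner_add_left, ← toEuclidean_add]
    congr 2
    simp [walkShift]

lemma increment_prepend (ω : Env d) (e : Jump d) {X : ℕ → Lattice d} (hX : X 0 = 0) :
    increment l (ω, prepend e.1 X) = inner ℝ (toEuclidean e.1) l := by
  simp [increment, prepend, hX]

variable (ν : Measure (Env d)) [IsProbabilityMeasure ν]

lemma integrable_increment : Integrable (increment l) (jointLaw ν 0) := by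
  refine ⟨(measurable_increment l).aestronglyMeasurable, ?_⟩
  rw [HasFiniteIntegral, lintegral_jointLaw ν 0 (measurable_increment l).enorm]
  have h : ∀ ω : Env d, ∫⁻ X, ‖increment l (ω, X)‖ₑ ∂(quenchedLaw 0 ω) ≤
      ∑ e : Jump d, ‖inner ℝ (toEuclidean e.1) l‖ₑ := by
    intro ω
    rw [lintegral_quenchedLaw ω (g := fun X => ‖increment l (ω, X)‖ₑ)
      ((measurable_increment l).enorm.comp measurable_prodMk_left)]
    refine Finset.sum_le_sum fun e _ => ?_
    have : ∫⁻ X, ‖increment l (ω, prepend e.1 X)‖ₑ ∂(quenchedLaw 0 (shift e.1 ω)) =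
        ‖inner ℝ (toEuclidean e.1) l‖ₑ := by
      rw [lintegral_congr_ae (g := fun _ => ‖inner ℝ (toEuclidean e.1) l‖ₑ)]
      · simp
      · filter_upwards [ae_quenchedLaw_zero 0 (shift e.1 ω)] with X hX
        rw [increment_prepend l ω e hX]
    rw [this]
    exact mul_le_of_le_one_left zero_le
      (ENNReal.ofReal_le_one.2 (jumpProb_le_one ω 0 e))
  refine (lintegral_mono h).trans_lt ?_
  simp [ENNReal.sum_lt_top]

lemma measurable_localDrift : Measurable fun ω : Env d => localDrift 0 ω :=
  Finset.measurable_sum _ fun e _ => (measurable_jumpProb e).smul_const _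

lemma integrable_localDrift : Integrable (fun ω : Env d => localDrift 0 ω) ν := by
  refine .of_bound measurable_localDrift.aestronglyMeasurable
    (∑ e : Jump d, ‖toEuclidean e.1‖) (ae_of_all _ fun ω => ?_)
  refine (norm_sum_le _ _).trans (Finset.sum_le_sum fun e _ => ?_)
  rw [norm_smul, Real.norm_of_nonneg (jumpProb_nonneg ω 0 e)]
  exact mul_le_of_le_one_left (norm_nonneg _) (jumpProb_le_one ω 0 e)

lemma integral_increment_quenchedLaw (ω : Env d) :
    ∫ X, increment l (ω, X) ∂(quenchedLaw 0 ω) = inner ℝ (localDrift 0 ω) l := by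
  have hm : Measurable fun X => increment l (ω, X) :=
    (measurable_increment l).comp measurable_prodMk_left
  have hae : ∀ e : Jump d, ∀ᵐ X ∂(quenchedLaw 0 (shift e.1 ω)),
      increment l (ω, prepend e.1 X) = inner ℝ (toEuclidean e.1) l := fun e => by
    filter_upwards [ae_quenchedLaw_zero 0 (shift e.1 ω)] with X hX
    exact increment_prepend l ω e hX
  rw [quenchedLaw_eq_sum, integral_finsetSum_measure fun e _ => ?_, localDrift, sum_inner]
  · refine Finset.sum_congr rfl fun e _ => ?_
    rw [integral_smul_measure, integral_map (measurable_prepend _).aemeasurable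
      hm.aestronglyMeasurable, integral_congr_ae (hae e), inner_smul_left]
    simp [ENNReal.toReal_ofReal (jumpProb_nonneg ω 0 e)]
  · refine Integrable.smul_measure ?_ ENNReal.ofReal_ne_top
    rw [integrable_map_measure hm.aestronglyMeasurable (measurable_prepend _).aemeasurable]
    exact (integrable_const _).congr ((hae e).mono fun X hX => hX.symm)

lemma integral_increment :
    ∫ p, increment l p ∂(jointLaw ν 0) = inner ℝ (∫ ω, localDrift 0 ω ∂ν) l := by
  have h := Measure.integral_compProd (integrable_increment l ν)
  rw [jointLaw, h, real_inner_comm, ← integral_inner (integrable_localDrift ν)]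
  refine integral_congr_ae (ae_of_all _ fun ω => ?_)
  simp only
  rw [real_inner_comm]
  exact integral_increment_quenchedLaw l ω

lemma ae_jointLaw_zero (ν : Measure (Env d)) [IsProbabilityMeasure ν] :
    ∀ᵐ p ∂(jointLaw ν 0), p.2 0 = 0 := by
  refine Measure.ae_compProd_of_ae_ae
    (measurable_snd (measurable_eval_traj 0 (measurableSet_singleton 0)))
    (ae_of_all _ fun ω => ae_quenchedLaw_zero 0 ω)

end Velocity

end RWRE

/-! ### Law of large numbers and ballisticity -/

open RWRE

theorem mainTheorem3 {d : ℕ} (P : MeasureTheory.Measure (RWRE.Env d))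
    [MeasureTheory.IsProbabilityMeasure P]
    (hE : RWRE.IsElliptic P) (hErg : RWRE.IsTotallyErgodic P)
    (ν : MeasureTheory.Measure (RWRE.Env d)) [MeasureTheory.IsProbabilityMeasure ν]
    (hν : RWRE.IsEnvInvariant ν) (hac : ν ≪ P) :
    (∀ᵐ p ∂(RWRE.jointLaw P 0),
      Tendsto (fun n : ℕ => (n : ℝ)⁻¹ • RWRE.toEuclidean (p.2 n)) atTop
        (𝓝 (∫ ω, RWRE.localDrift 0 ω ∂ν))) ∧
    ∀ l : EuclideanSpace ℝ (Fin d), ‖l‖ = 1 → RWRE.IsTransientInDirection P l →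
      RWRE.IsBallisticInDirection P l ∧ inner ℝ (∫ ω, RWRE.localDrift 0 ω ∂ν) l ≠ 0 := by
  have hEν : ∀ᵐ ω ∂ν, ∀ e : Jump d, 0 < ω 0 e := hac.ae_le (hE 0)
  have hT := ergodic_walkShift hErg hν hac hEν
  have hPν : jointLaw P 0 ≪ jointLaw ν 0 :=
    (absolutelyContinuous_of_isEnvInvariant hErg hν hac hEν).compProd_left _
  have hνP : jointLaw ν 0 ≪ jointLaw P 0 := hac.compProd_left _
  have hlim : ∀ l : EuclideanSpace ℝ (Fin d), ∀ᵐ p ∂(jointLaw P 0),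
      Tendsto (fun n : ℕ => inner ℝ (RWRE.toEuclidean (p.2 n)) l / n) atTop
        (𝓝 (inner ℝ (∫ ω, localDrift 0 ω ∂ν) l)) := by
    intro l
    refine hPν.ae_le ?_
    filter_upwards [ae_tendsto_birkhoffSum_div hT (measurable_increment l)
      (integrable_increment l ν), ae_jointLaw_zero ν] with p hp hp0
    simpa only [birkhoffSum_increment, hp0, sub_zero, integral_increment] using hp
  refine ⟨?_, fun l _ htr => ?_⟩
  · filter_upwards [ae_all_iff.2 fun i => hlim (EuclideanSpace.single i 1)] with p hp
    have h : Tendsto (fun n : ℕ => WithLp.ofLp ((n : ℝ)⁻¹ • RWRE.toEuclidean (p.2 n))) atTop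
        (𝓝 (WithLp.ofLp (∫ ω, localDrift 0 ω ∂ν))) := by
      refine tendsto_pi_nhds.2 fun i => ?_
      simpa [EuclideanSpace.inner_single_right, div_eq_inv_mul] using hp i
    exact ((PiLp.continuous_toLp 2 _).tendsto _).comp h
  · have htr' : ∀ᵐ p ∂(jointLaw P 0),
        Tendsto (fun n : ℕ => inner ℝ (RWRE.toEuclidean (p.2 n)) l) atTop atTop :=
      ae_of_ae_map measurable_snd.aemeasurable htr
    have hpos : 0 < inner ℝ (∫ ω, localDrift 0 ω ∂ν) l := by
      rw [← integral_increment]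
      refine integral_pos_of_tendsto_birkhoffSum_atTop hT (measurable_increment l)
        (integrable_increment l ν) ?_
      -- Transience is assumed under `P`, while ergodicity holds under ν; `ν ≪ P` bridges the two.
      filter_upwards [hνP.ae_le htr', ae_jointLaw_zero ν] with p hp hp0
      simpa only [birkhoffSum_increment, hp0, sub_zero] using hp
    refine ⟨?_, hpos.ne'⟩
    have hmeas : MeasurableSet {X : ℕ → Lattice d |
        0 < liminf (fun n : ℕ => ((inner ℝ (RWRE.toEuclidean (X n)) l / n : ℝ) : EReal)) atTop} := by
      refine measurableSet_lt measurable_const (Measurable.liminf fun n => ?_)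
      exact (measurable_of_countable fun y : Lattice d =>
        ((inner ℝ (RWRE.toEuclidean y) l / n : ℝ) : EReal)).comp (measurable_eval_traj n)
    refine (ae_map_iff measurable_snd.aemeasurable hmeas).2 ?_
    filter_upwards [hlim l] with p hp
    exact (EReal.coe_pos.2 hpos).trans_eq
      ((continuous_coe_real_ereal.tendsto _).comp hp).liminf_eq.symm
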